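/- A (finite) Young function is a convex even function $\Phi:\mathbb R\to[0,\infty)$ with $\Phi(0)=0$ and $\Phi(x)\to\infty$ as $x\to\infty$. It is a Mulholland Young function if moreover it is continuous, strictly increasing on $[0,\infty)$, and $\log\Phi(x)$ is a convex function of $\log x$ for $x>0$; its characteristic function is the function $\chi:\mathbb R\to\mathbb R$ with $\Phi(x)=|x|e^{\chi(\ln|x|)}$ for $x\ne0$. For Banach spaces $X_1,X_2$ over $\mathbb K\in\{\mathbb R,\mathbb C\}$ put $$d_\Phi\big((x_1,x_2),(y_1,y_2)\big)=\Phi^{-1}\big(\Phi(\|x_1-y_1\|)+\Phi(\|x_2-y_2\|)\big),$$ where $\Phi^{-1}$ is the inverse of $\Phi|_{[0,\infty)}$. An F-space is a vector space with a complete translation invariant metric $d$ for which the vector space operations are continuous; $\|x\|_F=d(x,0)$. It is locally bounded if some open neighbourhood $A$ of $0$ has the property that for each open neighbourhood $U$ of $0$ there is $t>0$ with $A\subset sU$ for all $s>t$. A Banach subspace of an F-space is a complete linear subspace on which $\|\alpha v\|_F=|\alpha|\,\|v\|_F$ for all scalars $\alpha$; it is maximal if it is not properly contained in another Banach subspace.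 If the continuous dual separates points, the Banach envelope is the space with the norm $\|x\|_C=\inf\{\lambda>0: x/\lambda\in C\}$, where $C$ is the closed convex hull of $\{x:\|x\|_F\le1\}$. A $p$-interpolation F-space for $X_1,X_2$ is a locally bounded F-space which contains distance preserving linear copies of $X_1$ and of $X_2$ as maximal Banach subspaces, and whose Banach envelope is (isometrically) the $p$-direct sum $X_1\oplus_pX_2$, with norm $\|(x_1,x_2)\|_p=(\|x_1\|^p+\|x_2\|^p)^{1/p}$. Theorem. Let $X_1,X_2$ be nonzero Banach spaces over $\mathbb K$ and let $1\le p<\infty$. (1) There is a Mulholland Young function $\Omega$ such that $d_\Omega$ is a metric and $(X_1\oplus X_2,d_\Omega)$ is a $p$-interpolation F-space for $X_1,X_2$. More precisely, $x\mapsto(x,0)$ and $y\mapsto(0,y)$ are distance preserving maps of $X_1$ and $X_2$ onto maximal Banach subspaces of $(X_1\oplus X_2,d_\Omega)$, and the norm of its Banach envelope is equal to $\|\cdot\|_p$. (2) If $p>1$, then for each $\varepsilon>0$ there is a Mulholland Young function $\Omega$ whose characteristic function $\chi$ is piecewise linear, with slope $m_r$ on $[r\ln2,(r+1)\ln2]$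 for $r=0,1,2,\dots$ and slope $m_0$ on $(-\infty,0]$, where $0<m_0<m_1<\cdots$ and $m_r\to p-1$, and has the line $y=(p-1)x-\ln p$ as its asymptote at $+\infty$, such that $d_\Omega$ is a metric, $(X_1\oplus X_2,d_\Omega)$ is a locally bounded F-space with separating dual, $x\mapsto(x,0)$ and $y\mapsto(0,y)$ are distance preserving maps onto maximal Banach subspaces, and the norm of its Banach envelope satisfies $\|x\|_p\le\|x\|_C\le(1+\varepsilon)\|x\|_p$ for all $x\in X_1\oplus X_2$. -/

import Mathlib

open Set Filter Topology
open scoped Pointwise ENNReal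

/-! ### Young functions -/

/-- A finite (real-valued) Young function: convex, even, nonnegative, zero at zero and tending to
infinity.  Continuity is automatic for a finite convex function on the line. -/
structure IsFiniteYoungFunction (Φ : ℝ → ℝ) : Prop where
  nonneg : ∀ x, 0 ≤ Φ x
  convex : ConvexOn ℝ univ Φ
  even : ∀ x, Φ (-x) = Φ x
  map_zero : Φ 0 = 0
  tendsto_atTop : Tendsto Φ atTop atTop

/-- A Young function satisfying the Mulholland condition: it is finite, continuous and strictly
increasing on `[0, ∞)`, and `log Φ(x)` is a convex function of `log x`. -/
structure IsMulhollandYoungFunction (Φ : ℝ → ℝ) : Prop extends IsFiniteYoungFunction Φ where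
  continuous : Continuous Φ
  strictMono : StrictMonoOn Φ (Ici 0)
  logConvex : ConvexOn ℝ univ (fun u : ℝ => Real.log (Φ (Real.exp u)))

/-- `χ` is the characteristic function of `Φ`, that is `Φ(x) = |x| exp(χ(log |x|))`. -/
def IsCharacteristicFunction (χ Φ : ℝ → ℝ) : Prop :=
  ∀ x : ℝ, x ≠ 0 → Φ x = |x| * Real.exp (χ (Real.log |x|))

/-- `χ` has slope `m r` on each interval `[r log 2, (r + 1) log 2]`, `r = 0, 1, 2, …`, and
slope `m 0` on `(-∞, 0]`. -/
def IsPiecewiseLinearWithSlopes (χ : ℝ → ℝ) (m : ℕ → ℝ) : Prop :=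
  (∀ r : ℕ, ∀ x ∈ Icc (r * Real.log 2) ((r + 1) * Real.log 2),
      χ x = χ (r * Real.log 2) + m r * (x - r * Real.log 2)) ∧
    ∀ x ≤ 0, χ x = χ 0 + m 0 * x

/-- The line `y = a x + b` is an asymptote of `χ` at `+∞`. -/
def HasAsymptoteAtTop (χ : ℝ → ℝ) (a b : ℝ) : Prop :=
  Tendsto (fun x => χ x - (a * x + b)) atTop (𝓝 0)

/-- The inverse of the restriction of `Φ` to `[0, ∞)`. -/
noncomputable def youngInv (Φ : ℝ → ℝ) : ℝ → ℝ := Function.invFunOn Φ (Ici 0)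

/-! ### F-spaces -/

section FSpace

variable (𝕜 : Type*) [RCLike 𝕜]
variable (X : Type*) [AddCommGroup X] [Module 𝕜 X] [MetricSpace X]

/-- A vector space with a metric is an F-space if the vector space operations are continuous and
the metric is translation invariant and complete. -/
structure IsFSpace : Prop where
  continuousSMul : ContinuousSMul 𝕜 X
  continuousAdd : ContinuousAdd X
  dist_add_right : ∀ x y a : X, dist (x + a) (y + a) = dist x y
  complete : CompleteSpace X

/-- Some open neighbourhood `A` of `0` is absorbed by every open neighbourhood of `0`. -/
def IsLocallyBoundedSpace : Prop :=
  ∃ A : Set X, IsOpen A ∧ (0 : X) ∈ A ∧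
    ∀ U : Set X, IsOpen U → (0 : X) ∈ U → ∃ t : ℝ, 0 < t ∧ ∀ s : ℝ, t < s → A ⊆ (s : 𝕜) • U

/-- The continuous linear functionals separate points. -/
def HasSeparatingDual : Prop :=
  ∀ x : X, x ≠ 0 → ∃ f : X →L[𝕜] 𝕜, f x ≠ 0

variable {X}

/-- A Banach subspace: the F-norm `x ↦ dist x 0` is homogeneous on it and it is complete. -/
def IsBanachSubspace (V : Submodule 𝕜 X) : Prop :=
  (∀ v ∈ V, ∀ c : 𝕜, dist (c • v) 0 = ‖c‖ * dist v 0) ∧ IsComplete (V : Set X)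

/-- `i` is a distance preserving linear map onto a maximal Banach subspace. -/
def IsMaximalBanachEmbedding {Y : Type*} [NormedAddCommGroup Y] [NormedSpace 𝕜 Y]
    (i : Y →ₗ[𝕜] X) : Prop :=
  Isometry i ∧ Maximal (IsBanachSubspace 𝕜) (LinearMap.range i)

variable (X)

/-- The closed convex hull of the closed unit ball (with `X` regarded as a real space). -/
def envelopeBall : Set X :=
  letI : Module ℝ X := Module.compHom X (algebraMap ℝ 𝕜)
  closure (convexHull ℝ (Metric.closedBall (0 : X) 1))

variable {X}

/-- The gauge of the closed convex hull of the closed unit ball. -/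
noncomputable def envelopeNorm (x : X) : ℝ :=
  sInf {r : ℝ | 0 < r ∧ (r : 𝕜)⁻¹ • x ∈ envelopeBall 𝕜 X}

/-- The Banach space `Y` is the Banach envelope of `X` under the linear identification `e`:
the dual of `X` separates points, and `e` carries the envelope norm to the norm of `Y`. -/
structure IsBanachEnvelope {Y : Type*} [NormedAddCommGroup Y] [NormedSpace 𝕜 Y]
    (e : X ≃ₗ[𝕜] Y) : Prop where
  separating : HasSeparatingDual 𝕜 X
  complete : CompleteSpace Y
  norm_eq : ∀ x, ‖e x‖ = envelopeNorm 𝕜 x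

variable (X)

/-- `X` is a `p`-interpolation F-space for the Banach spaces `X₁` and `X₂`. -/
structure IsPInterpolationFSpace (p : ℝ≥0∞) [Fact (1 ≤ p)]
    (X₁ : Type*) [NormedAddCommGroup X₁] [NormedSpace 𝕜 X₁]
    (X₂ : Type*) [NormedAddCommGroup X₂] [NormedSpace 𝕜 X₂] : Prop where
  isFSpace : IsFSpace 𝕜 X
  locallyBounded : IsLocallyBoundedSpace 𝕜 X
  exists_left : ∃ i : X₁ →ₗ[𝕜] X, IsMaximalBanachEmbedding 𝕜 i
  exists_right : ∃ i : X₂ →ₗ[𝕜] X, IsMaximalBanachEmbedding 𝕜 i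
  envelope : ∃ e : X ≃ₗ[𝕜] WithLp p (X₁ × X₂), IsBanachEnvelope 𝕜 e

end FSpace

/-! ### The direct sum -/

/-- The algebraic direct sum of two vector spaces, carrying no topology. -/
def VSum (X₁ X₂ : Type*) : Type _ := X₁ × X₂

namespace VSum

section

variable (𝕜 : Type*) [RCLike 𝕜]
variable (X₁ : Type*) [NormedAddCommGroup X₁] [NormedSpace 𝕜 X₁]
variable (X₂ : Type*) [NormedAddCommGroup X₂] [NormedSpace 𝕜 X₂]

instance : AddCommGroup (VSum X₁ X₂) := inferInstanceAs (AddCommGroup (X₁ × X₂))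

instance : Module 𝕜 (VSum X₁ X₂) := inferInstanceAs (Module 𝕜 (X₁ × X₂))

/-- The embedding `x ↦ (x, 0)`. -/
def inl : X₁ →ₗ[𝕜] VSum X₁ X₂ := LinearMap.inl 𝕜 X₁ X₂

/-- The embedding `y ↦ (0, y)`. -/
def inr : X₂ →ₗ[𝕜] VSum X₁ X₂ := LinearMap.inr 𝕜 X₁ X₂

/-- The identity of the direct sum, onto the `p`-direct sum. -/
def toLp (p : ℝ≥0∞) : VSum X₁ X₂ ≃ₗ[𝕜] WithLp p (X₁ × X₂) :=
  (WithLp.linearEquiv p 𝕜 (X₁ × X₂)).symm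

variable {X₁ X₂}

/-- `d_Φ(x, y) = Φ⁻¹(Φ(‖x₁ - y₁‖) + Φ(‖x₂ - y₂‖))`. -/
noncomputable def youngDist (Φ : ℝ → ℝ) (x y : VSum X₁ X₂) : ℝ :=
  youngInv Φ (Φ ‖x.1 - y.1‖ + Φ ‖x.2 - y.2‖)

end

end VSum

/-! The triangle inequality for $d_\Phi$ is Mulholland's inequality (`mulholland`), and
$\max(\|x_1\|,\|x_2\|)\le d_\Phi(x,0)\le\|x_1\|+\|x_2\|$ identifies the space uniformly with the
product.

The rest depends on two features of $\chi$ (`IsBentCharacteristic`). It has slope $s$ on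
$(-\infty,0]$, so $\Phi$ is a multiple of $t^{1+s}$ on $[0,1]$: the unit ball is that of the
$(1+s)$-sum, already closed and convex, and the envelope norm is the $(1+s)$-norm. It is not affine
on the whole line, so no $k$ satisfies $2\Phi(t)=\Phi(kt)$ for all $t>0$. Homogeneity along a vector
with components of equal nonzero norm would give such a $k$, and any subspace strictly larger than
$X_1$ or $X_2$ contains such a vector; hence maximality.

For (1), $s=p-1$ with a kink at $0$. For (2), the slopes are $p-1-d/2^r$, the envelope norm is the
$(p-d)$-norm, and $d\to0$ makes it close to the $p$-norm. -/

/-! ### The inverse of a Young function and Mulholland's inequality. -/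

namespace IsMulhollandYoungFunction

variable {Φ : ℝ → ℝ}

theorem surjOn (hΦ : IsMulhollandYoungFunction Φ) : SurjOn Φ (Ici 0) (Ici 0) := by
  intro y hy
  obtain ⟨b, hb, hb0⟩ := ((hΦ.tendsto_atTop.eventually_ge_atTop y).and
    (eventually_ge_atTop 0)).exists
  obtain ⟨x, hx, hxy⟩ := intermediate_value_Icc hb0 hΦ.continuous.continuousOn
    (show y ∈ Icc (Φ 0) (Φ b) from ⟨by simpa [hΦ.map_zero] using hy, hb⟩)
  exact ⟨x, hx.1, hxy⟩

theorem youngInv_nonneg (hΦ : IsMulhollandYoungFunction Φ)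
    {y : ℝ} (hy : 0 ≤ y) : 0 ≤ youngInv Φ y :=
  Function.invFunOn_mem (hΦ.surjOn hy)

theorem apply_youngInv (hΦ : IsMulhollandYoungFunction Φ)
    {y : ℝ} (hy : 0 ≤ y) : Φ (youngInv Φ y) = y :=
  Function.invFunOn_eq (hΦ.surjOn hy)

theorem youngInv_apply (hΦ : IsMulhollandYoungFunction Φ)
    {a : ℝ} (ha : 0 ≤ a) : youngInv Φ (Φ a) = a :=
  hΦ.strictMono.injOn (hΦ.youngInv_nonneg (hΦ.nonneg a)) ha (hΦ.apply_youngInv (hΦ.nonneg a))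

theorem le_iff (hΦ : IsMulhollandYoungFunction Φ)
    {a b : ℝ} (ha : 0 ≤ a) (hb : 0 ≤ b) : Φ a ≤ Φ b ↔ a ≤ b :=
  hΦ.strictMono.le_iff_le ha hb

theorem youngInv_le_iff (hΦ : IsMulhollandYoungFunction Φ)
    {y a : ℝ} (hy : 0 ≤ y) (ha : 0 ≤ a) : youngInv Φ y ≤ a ↔ y ≤ Φ a := by
  rw [← hΦ.le_iff (hΦ.youngInv_nonneg hy) ha, hΦ.apply_youngInv hy]

theorem le_youngInv_iff (hΦ : IsMulhollandYoungFunction Φ)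
    {y a : ℝ} (hy : 0 ≤ y) (ha : 0 ≤ a) : a ≤ youngInv Φ y ↔ Φ a ≤ y := by
  rw [← hΦ.le_iff ha (hΦ.youngInv_nonneg hy), hΦ.apply_youngInv hy]

theorem pos (hΦ : IsMulhollandYoungFunction Φ) {a : ℝ} (ha : 0 < a) : 0 < Φ a := by
  simpa [hΦ.map_zero] using hΦ.strictMono (mem_Ici.2 le_rfl) ha.le ha

/-- The ratio `Φ(l a) / Φ(a)` is nondecreasing in `a`, for `l ≥ 1`. -/
theorem ratio_mono (hΦ : IsMulhollandYoungFunction Φ)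
    {a b l : ℝ} (ha : 0 ≤ a) (hab : a ≤ b) (hl : 1 ≤ l) :
    Φ (l * a) * Φ b ≤ Φ a * Φ (l * b) := by
  rcases ha.eq_or_lt with rfl | ha
  · simp [hΦ.map_zero]
  have hb : 0 < b := ha.trans_le hab
  have hl0 : 0 < l := one_pos.trans_le hl
  rcases hl.eq_or_lt with rfl | hl
  · simp
  rcases hab.eq_or_lt with rfl | hab
  · exact (mul_comm _ _).le
  set u := Real.log a
  set v := Real.log b
  set h := Real.log l
  have hh : 0 < h := Real.log_pos hl
  have huv : u < v := Real.log_lt_log ha hab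
  have hu : Real.exp u = a := Real.exp_log ha
  have hv : Real.exp v = b := Real.exp_log hb
  have hlexp : Real.exp h = l := Real.exp_log hl0
  -- Both $u+h$ and $v$ lie between $u$ and $v+h$, and with this $t$ they are convex combinations
  -- with swapped weights. Adding the two convexity inequalities cancels the weights.
  set t := h / (v + h - u) with ht
  have hd : 0 < v + h - u := by linarith
  have ht0 : 0 ≤ t := by positivity
  have ht1 : 0 ≤ 1 - t := by
    rw [ht, sub_nonneg, div_le_one hd]; linarith
  have hth : t * (v + h - u) = h := div_mul_cancel₀ _ hd.ne'
  have h1 := hΦ.logConvex.2 (mem_univ u) (mem_univ (v + h)) ht1 ht0 (by ring)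
  have h2 := hΦ.logConvex.2 (mem_univ u) (mem_univ (v + h)) ht0 ht1 (by ring)
  simp only [smul_eq_mul] at h1 h2
  rw [show (1 - t) * u + t * (v + h) = u + h by linarith] at h1
  rw [show t * u + (1 - t) * (v + h) = v by linarith] at h2
  rw [Real.exp_add, Real.exp_add, hlexp, hu, hv, mul_comm a, mul_comm b] at h1
  rw [Real.exp_add, hlexp, hu, hv, mul_comm b] at h2
  have p1 := hΦ.pos ha
  have p2 := hΦ.pos hb
  have p3 := hΦ.pos (mul_pos hl0 ha)
  have p4 := hΦ.pos (mul_pos hl0 hb)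
  rw [← Real.log_le_log_iff (by positivity) (by positivity), Real.log_mul p3.ne' p2.ne',
    Real.log_mul p1.ne' p4.ne']
  linarith

/-- Since $a_i\le A$, `ratio_mono` bounds each $\Phi(la_i)/\Phi(a_i)$ by $\Phi(lA)/\Phi(A)$. -/
theorem sum_scale_le (hΦ : IsMulhollandYoungFunction Φ)
    {a₁ a₂ A l : ℝ} (h₁ : 0 ≤ a₁) (h₂ : 0 ≤ a₂) (hA : 0 < A) (hl : 1 ≤ l)
    (h : Φ a₁ + Φ a₂ = Φ A) : Φ (l * a₁) + Φ (l * a₂) ≤ Φ (l * A) := by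
  have e₁ := hΦ.ratio_mono h₁ ((hΦ.le_iff h₁ hA.le).1 (by linarith [hΦ.nonneg a₂])) hl
  have e₂ := hΦ.ratio_mono h₂ ((hΦ.le_iff h₂ hA.le).1 (by linarith [hΦ.nonneg a₁])) hl
  refine le_of_mul_le_mul_right ?_ (hΦ.pos hA)
  rw [add_mul, mul_comm (Φ (l * A)), ← h, add_mul, h]
  exact add_le_add e₁ e₂

/-- **Mulholland's inequality** for two summands. -/
theorem mulholland (hΦ : IsMulhollandYoungFunction Φ)
    {a₁ a₂ b₁ b₂ A B : ℝ} (ha₁ : 0 ≤ a₁) (ha₂ : 0 ≤ a₂) (hb₁ : 0 ≤ b₁)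
    (hb₂ : 0 ≤ b₂) (hA : 0 ≤ A) (hB : 0 ≤ B) (hA' : Φ a₁ + Φ a₂ = Φ A)
    (hB' : Φ b₁ + Φ b₂ = Φ B) : Φ (a₁ + b₁) + Φ (a₂ + b₂) ≤ Φ (A + B) := by
  have la₁ : a₁ ≤ A := (hΦ.le_iff ha₁ hA).1 (by linarith [hΦ.nonneg a₂])
  have la₂ : a₂ ≤ A := (hΦ.le_iff ha₂ hA).1 (by linarith [hΦ.nonneg a₁])
  have lb₁ : b₁ ≤ B := (hΦ.le_iff hb₁ hB).1 (by linarith [hΦ.nonneg b₂])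
  have lb₂ : b₂ ≤ B := (hΦ.le_iff hb₂ hB).1 (by linarith [hΦ.nonneg b₁])
  rcases hA.eq_or_lt with rfl | hA
  · obtain rfl := le_antisymm la₁ ha₁
    obtain rfl := le_antisymm la₂ ha₂
    simpa using hB'.le
  rcases hB.eq_or_lt with rfl | hB
  · obtain rfl := le_antisymm lb₁ hb₁
    obtain rfl := le_antisymm lb₂ hb₂
    simpa using hA'.le
  -- Here $x+y$ is a convex combination with weights proportional to $A$ and $B$; the dilations
  -- $(A+B)/A$ and $(A+B)/B$ are at least $1$ and carry both $A$ and $B$ to $A+B$, as `sum_scale_le`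
  -- needs.
  have key : ∀ x y : ℝ, Φ (x + y) ≤
      A / (A + B) * Φ ((A + B) / A * x) + B / (A + B) * Φ ((A + B) / B * y) := by
    intro x y
    have := hΦ.convex.2 (mem_univ ((A + B) / A * x)) (mem_univ ((A + B) / B * y))
      (show 0 ≤ A / (A + B) by positivity) (show 0 ≤ B / (A + B) by positivity) (by field_simp)
    simp only [smul_eq_mul] at this
    rwa [← mul_assoc, ← mul_assoc, div_mul_div_cancel₀ (by positivity : A + B ≠ 0),
      div_mul_div_cancel₀ (by positivity : A + B ≠ 0), div_self hA.ne', div_self hB.ne', one_mul,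
      one_mul] at this
  have s₁ := hΦ.sum_scale_le ha₁ ha₂ hA (l := (A + B) / A)
    (by rw [le_div_iff₀ hA]; linarith) hA'
  have s₂ := hΦ.sum_scale_le hb₁ hb₂ hB (l := (A + B) / B)
    (by rw [le_div_iff₀ hB]; linarith) hB'
  rw [div_mul_cancel₀ _ hA.ne'] at s₁
  rw [div_mul_cancel₀ _ hB.ne'] at s₂
  calc Φ (a₁ + b₁) + Φ (a₂ + b₂)
      ≤ A / (A + B) * (Φ ((A + B) / A * a₁) + Φ ((A + B) / A * a₂)) +
        B / (A + B) * (Φ ((A + B) / B * b₁) + Φ ((A + B) / B * b₂)) := by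
        linarith [key a₁ b₁, key a₂ b₂]
    _ ≤ A / (A + B) * Φ (A + B) + B / (A + B) * Φ (A + B) := by gcongr
    _ = Φ (A + B) := by field_simp

end IsMulhollandYoungFunction

/-! ### The metric $d_\Phi$. -/

namespace VSum

variable {X₁ X₂ : Type*} [NormedAddCommGroup X₁] [NormedAddCommGroup X₂] {Φ : ℝ → ℝ}

theorem norm_fst_sub_le_youngDist (hΦ : IsMulhollandYoungFunction Φ) (x y : VSum X₁ X₂) :
    ‖x.1 - y.1‖ ≤ youngDist Φ x y :=
  (hΦ.le_youngInv_iff (add_nonneg (hΦ.nonneg _) (hΦ.nonneg _)) (norm_nonneg _)).2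
    (le_add_of_nonneg_right (hΦ.nonneg _))

theorem norm_snd_sub_le_youngDist (hΦ : IsMulhollandYoungFunction Φ) (x y : VSum X₁ X₂) :
    ‖x.2 - y.2‖ ≤ youngDist Φ x y :=
  (hΦ.le_youngInv_iff (add_nonneg (hΦ.nonneg _) (hΦ.nonneg _)) (norm_nonneg _)).2
    (le_add_of_nonneg_left (hΦ.nonneg _))

theorem youngDist_le_iff (hΦ : IsMulhollandYoungFunction Φ) (x y : VSum X₁ X₂) {r : ℝ}
    (hr : 0 ≤ r) : youngDist Φ x y ≤ r ↔ Φ ‖x.1 - y.1‖ + Φ ‖x.2 - y.2‖ ≤ Φ r :=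
  hΦ.youngInv_le_iff (add_nonneg (hΦ.nonneg _) (hΦ.nonneg _)) hr

theorem youngDist_nonneg (hΦ : IsMulhollandYoungFunction Φ) (x y : VSum X₁ X₂) :
    0 ≤ youngDist Φ x y :=
  hΦ.youngInv_nonneg (add_nonneg (hΦ.nonneg _) (hΦ.nonneg _))

theorem apply_youngDist (hΦ : IsMulhollandYoungFunction Φ) (x y : VSum X₁ X₂) :
    Φ (youngDist Φ x y) = Φ ‖x.1 - y.1‖ + Φ ‖x.2 - y.2‖ :=
  hΦ.apply_youngInv (add_nonneg (hΦ.nonneg _) (hΦ.nonneg _))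

theorem youngDist_triangle (hΦ : IsMulhollandYoungFunction Φ) (x y z : VSum X₁ X₂) :
    youngDist Φ x z ≤ youngDist Φ x y + youngDist Φ y z := by
  rw [youngDist_le_iff hΦ _ _ (add_nonneg (youngDist_nonneg hΦ _ _) (youngDist_nonneg hΦ _ _))]
  refine le_trans (add_le_add ?_ ?_) (hΦ.mulholland (norm_nonneg _) (norm_nonneg _)
    (norm_nonneg _) (norm_nonneg _) (youngDist_nonneg hΦ x y) (youngDist_nonneg hΦ y z)
    (apply_youngDist hΦ x y).symm (apply_youngDist hΦ y z).symm)
  · exact (hΦ.le_iff (norm_nonneg _) (by positivity)).2 (norm_sub_le_norm_sub_add_norm_sub _ _ _)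
  · exact (hΦ.le_iff (norm_nonneg _) (by positivity)).2 (norm_sub_le_norm_sub_add_norm_sub _ _ _)

/-- Mulholland's inequality for the pairs $(\alpha,0)$ and $(0,\beta)$. -/
theorem youngDist_le_add (hΦ : IsMulhollandYoungFunction Φ) (x y : VSum X₁ X₂) :
    youngDist Φ x y ≤ ‖x.1 - y.1‖ + ‖x.2 - y.2‖ := by
  rw [youngDist_le_iff hΦ _ _ (by positivity)]
  simpa using hΦ.mulholland (norm_nonneg (x.1 - y.1)) le_rfl le_rfl (norm_nonneg (x.2 - y.2))
    (norm_nonneg _) (norm_nonneg _) (by simp [hΦ.map_zero]) (by simp [hΦ.map_zero])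

/-- The metric `d_Φ` on the direct sum. -/
noncomputable abbrev youngMetricSpace (hΦ : IsMulhollandYoungFunction Φ) :
    MetricSpace (VSum X₁ X₂) where
  dist := youngDist Φ
  dist_self x := by
    have := hΦ.youngInv_apply le_rfl
    simp_all [youngDist, hΦ.map_zero]
  dist_comm x y := by simp only [youngDist, norm_sub_rev]
  dist_triangle := youngDist_triangle hΦ
  eq_of_dist_eq_zero {x y} h := by
    have h : youngDist Φ x y = 0 := h
    refine Prod.ext (sub_eq_zero.1 (norm_le_zero_iff.1 ?_)) (sub_eq_zero.1 (norm_le_zero_iff.1 ?_))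
    · exact h ▸ norm_fst_sub_le_youngDist hΦ x y
    · exact h ▸ norm_snd_sub_le_youngDist hΦ x y

end VSum

/-! ### Young functions built from characteristic functions. -/

/-- The characteristic functions used for interpolation metrics: `χ` has a
nondecreasing supporting line at each point, is affine with slope `s` on `(-∞, 0]`, and is not
affine on the whole line. -/
structure IsBentCharacteristic (χ : ℝ → ℝ) (s : ℝ) : Prop where
  slope_nonneg : 0 ≤ s
  exists_support : ∀ u, ∃ m, 0 ≤ m ∧ ∀ v, χ u + m * (v - u) ≤ χ v
  eq_of_nonpos : ∀ u ≤ 0, χ u = χ 0 + s * u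
  exists_lt : ∃ u, χ 0 + s * u < χ u

/-- The even function with characteristic function `χ`. -/
noncomputable def youngOfCharacteristic (χ : ℝ → ℝ) (x : ℝ) : ℝ :=
  |x| * Real.exp (χ (Real.log |x|))

theorem isCharacteristicFunction_youngOfCharacteristic (χ : ℝ → ℝ) :
    IsCharacteristicFunction χ (youngOfCharacteristic χ) := fun _ _ => rfl

namespace IsBentCharacteristic

variable {χ : ℝ → ℝ} {s : ℝ}

theorem convexOn (h : IsBentCharacteristic χ s) : ConvexOn ℝ univ χ := by
  refine ⟨convex_univ, fun x _ y _ a b ha hb hab => ?_⟩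
  obtain ⟨m, -, hm⟩ := h.exists_support (a • x + b • y)
  have h₁ := mul_le_mul_of_nonneg_left (hm x) ha
  have h₂ := mul_le_mul_of_nonneg_left (hm y) hb
  simp only [smul_eq_mul] at *
  obtain rfl : b = 1 - a := by linarith
  linarith

theorem monotone (h : IsBentCharacteristic χ s) : Monotone χ := by
  intro u v huv
  obtain ⟨m, hm, hs⟩ := h.exists_support u
  nlinarith [hs v, mul_nonneg hm (sub_nonneg.2 huv)]

theorem line_le (h : IsBentCharacteristic χ s) (u : ℝ) : χ 0 + s * u ≤ χ u := by
  rcases le_total u 0 with hu | hu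
  · exact (h.eq_of_nonpos u hu).ge
  obtain ⟨m, hm, hs⟩ := h.exists_support 0
  have h₁ := hs (-1)
  rw [h.eq_of_nonpos (-1) (by norm_num)] at h₁
  nlinarith [hs u]

/-- Beyond a point where it is positive, the excess `χ u - (χ 0 + s u)` increases strictly. -/
theorem excess_strictMono (h : IsBentCharacteristic χ s) {u v : ℝ} (hu : χ 0 + s * u < χ u)
    (huv : u < v) : χ u - s * u < χ v - s * v := by
  have hu0 : 0 < u := by
    by_contra! hu'
    exact hu.ne' (h.eq_of_nonpos u hu')
  obtain ⟨m, hm, hs⟩ := h.exists_support u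
  -- The supporting line at $u$, evaluated at $0$, gives $\chi(u)-mu\le\chi(0)<\chi(u)-su$.
  have h₁ : s < m := by nlinarith [hs 0]
  nlinarith [hs v]

/-- A supporting line of $\chi$ with slope $m\ge0$ exponentiates to a power $C|t|^{1+m}$ that lies
below $\Phi$ and touches it at the chosen point. These powers are convex, hence so is $\Phi$;
continuity follows from convexity. -/
theorem isMulhollandYoungFunction (h : IsBentCharacteristic χ s) :
    IsMulhollandYoungFunction (youngOfCharacteristic χ) := by
  have hconv : ConvexOn ℝ univ (youngOfCharacteristic χ) := by
    refine ⟨convex_univ, fun x _ y _ a b ha hb hab => ?_⟩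
    rcases eq_or_ne (a • x + b • y) 0 with hz | hz
    · rw [hz]
      simp only [youngOfCharacteristic, abs_zero, zero_mul, smul_eq_mul]
      positivity
    obtain ⟨m, hm, hs⟩ := h.exists_support (Real.log |a • x + b • y|)
    set z := a • x + b • y
    have hz0 : 0 < |z| := abs_pos.2 hz
    set C := Real.exp (χ (Real.log |z|) - m * Real.log |z|)
    have hle : ∀ t, C * |t| ^ (1 + m) ≤ youngOfCharacteristic χ t := by
      intro t
      rcases eq_or_ne t 0 with rfl | ht
      · simp [youngOfCharacteristic, Real.zero_rpow (by positivity : 1 + m ≠ 0)]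
      have ht0 : 0 < |t| := abs_pos.2 ht
      rw [Real.rpow_add ht0, Real.rpow_one, Real.rpow_def_of_pos ht0, mul_left_comm, ← Real.exp_add,
        youngOfCharacteristic]
      gcongr
      linarith [hs (Real.log |t|)]
    have heq : youngOfCharacteristic χ z = C * |z| ^ (1 + m) := by
      rw [Real.rpow_add hz0, Real.rpow_one, Real.rpow_def_of_pos hz0, mul_left_comm, ← Real.exp_add,
        youngOfCharacteristic]
      ring_nf
    rw [heq]
    have hzle : |z| ≤ a * |x| + b * |y| := by
      refine (abs_add_le _ _).trans_eq ?_
      simp [abs_mul, abs_of_nonneg, ha, hb]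
    have hpow := (convexOn_rpow (by linarith : 1 ≤ 1 + m)).2 (abs_nonneg x) (abs_nonneg y) ha hb hab
    simp only [smul_eq_mul] at hpow ⊢
    calc C * |z| ^ (1 + m) ≤ C * (a * |x| ^ (1 + m) + b * |y| ^ (1 + m)) := by
          gcongr
          exact (Real.rpow_le_rpow (abs_nonneg z) hzle (by linarith)).trans hpow
      _ = a * (C * |x| ^ (1 + m)) + b * (C * |y| ^ (1 + m)) := by ring
      _ ≤ _ := by gcongr <;> apply hle
  refine
    { nonneg := fun x => mul_nonneg (abs_nonneg x) (Real.exp_pos _).le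
      convex := hconv
      even := fun x => by simp only [youngOfCharacteristic, abs_neg]
      map_zero := by simp [youngOfCharacteristic]
      tendsto_atTop := ?_
      continuous := continuousOn_univ.1 (hconv.continuousOn isOpen_univ)
      strictMono := ?_
      logConvex := ?_ }
  · refine tendsto_atTop_mono' _ ?_ (tendsto_id.atTop_mul_const (Real.exp_pos (χ 0)))
    filter_upwards [eventually_ge_atTop 1] with x hx
    rw [youngOfCharacteristic, abs_of_nonneg (by linarith), id]
    gcongr
    exact h.monotone (Real.log_nonneg hx)
  · intro x hx y hy hxy
    have hx : 0 ≤ x := hx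
    have hy : 0 < y := hx.trans_lt hxy
    simp only [youngOfCharacteristic, abs_of_nonneg hx, abs_of_pos hy]
    rcases hx.eq_or_lt with rfl | hx
    · simp; positivity
    · exact mul_lt_mul hxy (Real.exp_le_exp.2 (h.monotone (Real.log_le_log hx hxy.le)))
        (Real.exp_pos _) hy.le
  · have : (fun u : ℝ => Real.log (youngOfCharacteristic χ (Real.exp u))) = id + χ := by
      funext u
      simp only [youngOfCharacteristic, Pi.add_apply, id, abs_of_pos (Real.exp_pos u), Real.log_exp,
        ← Real.exp_add]
    rw [this]
    exact (convexOn_id convex_univ).add h.convexOn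

theorem young_eq_rpow (h : IsBentCharacteristic χ s) {t : ℝ} (ht : 0 ≤ t) (ht1 : t ≤ 1) :
    youngOfCharacteristic χ t = youngOfCharacteristic χ 1 * t ^ (1 + s) := by
  have hs := h.slope_nonneg
  rcases ht.eq_or_lt with rfl | ht
  · simp [youngOfCharacteristic, Real.zero_rpow (by positivity : 1 + s ≠ 0)]
  simp only [youngOfCharacteristic, abs_of_pos ht, abs_one, Real.log_one, one_mul]
  rw [h.eq_of_nonpos _ (Real.log_nonpos ht.le ht1), Real.rpow_add ht, Real.rpow_one,
    Real.rpow_def_of_pos ht, mul_left_comm, ← Real.exp_add, mul_comm s]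

/-- The unit ball of the Orlicz sum is that of the `(1 + s)`-sum. -/
theorem young_add_le_iff (h : IsBentCharacteristic χ s) {a b : ℝ} (ha : 0 ≤ a) (hb : 0 ≤ b) :
    youngOfCharacteristic χ a + youngOfCharacteristic χ b ≤ youngOfCharacteristic χ 1 ↔
      a ^ (1 + s) + b ^ (1 + s) ≤ 1 := by
  have hΦ := h.isMulhollandYoungFunction
  have hs := h.slope_nonneg
  have h1 := hΦ.pos one_pos
  -- Either inequality forces $a,b\le1$, so only the power range of $\Phi$ matters.
  have key : a ≤ 1 → b ≤ 1 →
      (youngOfCharacteristic χ a + youngOfCharacteristic χ b ≤ youngOfCharacteristic χ 1 ↔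
      a ^ (1 + s) + b ^ (1 + s) ≤ 1) := by
    intro ha1 hb1
    rw [h.young_eq_rpow ha ha1, h.young_eq_rpow hb hb1, ← mul_add, mul_le_iff_le_one_right h1]
  constructor
  · intro H
    exact (key ((hΦ.le_iff ha zero_le_one).1 (by linarith [hΦ.nonneg b]))
      ((hΦ.le_iff hb zero_le_one).1 (by linarith [hΦ.nonneg a]))).1 H
  · intro H
    have ha' := Real.rpow_nonneg ha (1 + s)
    have hb' := Real.rpow_nonneg hb (1 + s)
    refine (key ?_ ?_).2 H
    · exact (Real.rpow_le_rpow_iff ha zero_le_one (by linarith : 0 < 1 + s)).1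
        (by rw [Real.one_rpow]; linarith)
    · exact (Real.rpow_le_rpow_iff hb zero_le_one (by linarith : 0 < 1 + s)).1
        (by rw [Real.one_rpow]; linarith)

/-- Doubling the Young function is not a dilation of the argument. -/
theorem not_two_mul_eq (h : IsBentCharacteristic χ s) {k : ℝ} (hk : 0 < k) :
    ¬ ∀ t, 0 < t → 2 * youngOfCharacteristic χ t = youngOfCharacteristic χ (k * t) := by
  intro H
  have hs := h.slope_nonneg
  have H' : ∀ u, Real.log 2 + χ u = Real.log k + χ (Real.log k + u) := by
    intro u
    have := congrArg Real.log (H (Real.exp u) (Real.exp_pos u))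
    simp only [youngOfCharacteristic, abs_mul, abs_of_pos hk, abs_of_pos (Real.exp_pos u)] at this
    rw [Real.log_mul hk.ne' (Real.exp_pos u).ne', Real.log_exp, Real.log_mul two_ne_zero
      (by positivity), Real.log_mul (by positivity) (by positivity), Real.log_mul (by positivity)
      (by positivity), Real.log_mul (by positivity) (by positivity)] at this
    simp only [Real.log_exp] at this
    linarith
  set l := Real.log k
  have h2 : (0 : ℝ) < Real.log 2 := Real.log_pos one_lt_two
  -- At this point both arguments of $\chi$ are nonpositive, and the equation becomes $\log
  -- 2=(1+s)l$; in particular $l>0$.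
  have h₁ := H' (-|l|)
  rw [h.eq_of_nonpos _ (neg_nonpos.2 (abs_nonneg l)),
    h.eq_of_nonpos (l + -|l|) (by linarith [le_abs_self l])] at h₁
  have hl : 0 < l := by
    by_contra! hl
    nlinarith
  -- The equation now says that $\chi(u)-su$ has period $l$, while it increases strictly from a
  -- point where $\chi$ is above its initial line.
  obtain ⟨u, hu⟩ := h.exists_lt
  have h₃ := h.excess_strictMono hu (lt_add_of_pos_left u hl)
  linarith [H' u]

end IsBentCharacteristic

/-! ### F-space structure of the direct sum. -/

namespace VSum

section

variable {𝕜 : Type*} [RCLike 𝕜]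
variable {X₁ : Type*} [NormedAddCommGroup X₁] [NormedSpace 𝕜 X₁]
variable {X₂ : Type*} [NormedAddCommGroup X₂] [NormedSpace 𝕜 X₂]
variable {Φ : ℝ → ℝ} [MetricSpace (VSum X₁ X₂)]

theorem lipschitzWith_toProd (hΦ : IsMulhollandYoungFunction Φ)
    (hd : ∀ x y : VSum X₁ X₂, dist x y = youngDist Φ x y) :
    LipschitzWith 1 (fun x : VSum X₁ X₂ => (show X₁ × X₂ from x)) := by
  refine LipschitzWith.of_dist_le_mul fun x y => ?_
  rw [NNReal.coe_one, one_mul, hd, Prod.dist_eq, dist_eq_norm, dist_eq_norm]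
  exact max_le (norm_fst_sub_le_youngDist hΦ x y) (norm_snd_sub_le_youngDist hΦ x y)

theorem lipschitzWith_ofProd (hΦ : IsMulhollandYoungFunction Φ)
    (hd : ∀ x y : VSum X₁ X₂, dist x y = youngDist Φ x y) :
    LipschitzWith 2 (fun x : X₁ × X₂ => (show VSum X₁ X₂ from x)) := by
  refine LipschitzWith.of_dist_le_mul fun x y => ?_
  rw [hd]
  refine (youngDist_le_add hΦ _ _).trans ?_
  rw [NNReal.coe_ofNat, two_mul, dist_eq_norm]
  exact add_le_add (norm_fst_le (x - y)) (norm_snd_le (x - y))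

/-- The direct sum is uniformly equivalent to the product. -/
def uniformEquivProd (hΦ : IsMulhollandYoungFunction Φ)
    (hd : ∀ x y : VSum X₁ X₂, dist x y = youngDist Φ x y) : VSum X₁ X₂ ≃ᵤ X₁ × X₂ where
  toFun x := x
  invFun x := x
  left_inv _ := rfl
  right_inv _ := rfl
  uniformContinuous_toFun := (lipschitzWith_toProd hΦ hd).uniformContinuous
  uniformContinuous_invFun := (lipschitzWith_ofProd hΦ hd).uniformContinuous

theorem isFSpace [CompleteSpace X₁] [CompleteSpace X₂] (hΦ : IsMulhollandYoungFunction Φ)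
    (hd : ∀ x y : VSum X₁ X₂, dist x y = youngDist Φ x y) : IsFSpace 𝕜 (VSum X₁ X₂) where
  continuousSMul := (uniformEquivProd hΦ hd).toHomeomorph.isInducing.continuousSMul
    (f := (id : 𝕜 → 𝕜)) continuous_id rfl
  continuousAdd := by
    let f : VSum X₁ X₂ →+ X₁ × X₂ := AddMonoidHom.id (X₁ × X₂)
    exact Topology.IsInducing.continuousAdd f (uniformEquivProd hΦ hd).toHomeomorph.isInducing
  dist_add_right x y a := by
    rw [hd, hd]
    change youngInv Φ (Φ ‖(x.1 + a.1) - (y.1 + a.1)‖ + Φ ‖(x.2 + a.2) - (y.2 + a.2)‖) = _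
    rw [add_sub_add_right_eq_sub, add_sub_add_right_eq_sub]
    rfl
  complete := (uniformEquivProd hΦ hd).completeSpace_iff.2 inferInstance

theorem isLocallyBoundedSpace (hΦ : IsMulhollandYoungFunction Φ)
    (hd : ∀ x y : VSum X₁ X₂, dist x y = youngDist Φ x y) :
    IsLocallyBoundedSpace 𝕜 (VSum X₁ X₂) := by
  refine ⟨Metric.ball 0 1, Metric.isOpen_ball, Metric.mem_ball_self one_pos, fun U hU hU0 => ?_⟩
  obtain ⟨δ, hδ, hδU⟩ := Metric.isOpen_iff.1 hU 0 hU0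
  -- In the unit ball both components have norm below $1$, so $x/s$ is within $2/s<\delta$ of $0$.
  refine ⟨2 / δ, by positivity, fun s hs x hx => ?_⟩
  have hs0 : 0 < s := lt_trans (by positivity) hs
  rw [mem_smul_set_iff_inv_smul_mem₀ (RCLike.ofReal_ne_zero.2 hs0.ne')]
  apply hδU
  rw [Metric.mem_ball, hd] at hx ⊢
  refine (youngDist_le_add hΦ _ _).trans_lt ?_
  have h₁ := (norm_fst_sub_le_youngDist hΦ x 0).trans_lt hx
  have h₂ := (norm_snd_sub_le_youngDist hΦ x 0).trans_lt hx
  have e₁ : (x - 0 : VSum X₁ X₂).1 = x.1 := congrArg Prod.fst (sub_zero x)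
  have e₂ : (x - 0 : VSum X₁ X₂).2 = x.2 := congrArg Prod.snd (sub_zero x)
  change ‖(x - 0 : VSum X₁ X₂).1‖ < 1 at h₁
  change ‖(x - 0 : VSum X₁ X₂).2‖ < 1 at h₂
  rw [e₁] at h₁
  rw [e₂] at h₂
  change ‖(s : 𝕜)⁻¹ • x.1 - 0‖ + ‖(s : 𝕜)⁻¹ • x.2 - 0‖ < δ
  rw [sub_zero, sub_zero, norm_smul, norm_smul, norm_inv, RCLike.norm_ofReal, abs_of_pos hs0,
    ← mul_add, inv_mul_lt_iff₀ hs0]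
  rw [div_lt_iff₀ hδ] at hs
  linarith

theorem hasSeparatingDual (hΦ : IsMulhollandYoungFunction Φ)
    (hd : ∀ x y : VSum X₁ X₂, dist x y = youngDist Φ x y) : HasSeparatingDual 𝕜 (VSum X₁ X₂) := by
  intro x hx
  let T : VSum X₁ X₂ →L[𝕜] X₁ × X₂ :=
    ⟨(LinearMap.id : X₁ × X₂ →ₗ[𝕜] X₁ × X₂), (lipschitzWith_toProd hΦ hd).continuous⟩
  have hx' : T x ≠ 0 := hx
  obtain ⟨g, -, hg⟩ := exists_dual_vector 𝕜 (T x) (norm_ne_zero_iff.2 hx')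
  exact ⟨g.comp T, by simpa [hg] using hx'⟩

theorem dist_zero_eq (hd : ∀ x y : VSum X₁ X₂, dist x y = youngDist Φ x y) (x : VSum X₁ X₂) :
    dist x 0 = youngInv Φ (Φ ‖x.1‖ + Φ ‖x.2‖) := by
  rw [hd]
  change youngInv Φ (Φ ‖x.1 - 0‖ + Φ ‖x.2 - 0‖) = _
  rw [sub_zero, sub_zero]

theorem dist_zero_le_iff (hΦ : IsMulhollandYoungFunction Φ)
    (hd : ∀ x y : VSum X₁ X₂, dist x y = youngDist Φ x y) (x : VSum X₁ X₂) {r : ℝ} (hr : 0 ≤ r) :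
    dist x 0 ≤ r ↔ Φ ‖x.1‖ + Φ ‖x.2‖ ≤ Φ r := by
  rw [dist_zero_eq hd, hΦ.youngInv_le_iff (add_nonneg (hΦ.nonneg _) (hΦ.nonneg _)) hr]

theorem isometry_inl (hΦ : IsMulhollandYoungFunction Φ)
    (hd : ∀ x y : VSum X₁ X₂, dist x y = youngDist Φ x y) : Isometry (inl 𝕜 X₁ X₂) := by
  refine Isometry.of_dist_eq fun x y => ?_
  rw [hd]
  change youngInv Φ (Φ ‖x - y‖ + Φ ‖(0 : X₂) - 0‖) = _
  rw [sub_zero, norm_zero, hΦ.map_zero, add_zero, hΦ.youngInv_apply (norm_nonneg _), dist_eq_norm]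

theorem isometry_inr (hΦ : IsMulhollandYoungFunction Φ)
    (hd : ∀ x y : VSum X₁ X₂, dist x y = youngDist Φ x y) : Isometry (inr 𝕜 X₁ X₂) := by
  refine Isometry.of_dist_eq fun x y => ?_
  rw [hd]
  change youngInv Φ (Φ ‖(0 : X₁) - 0‖ + Φ ‖x - y‖) = _
  rw [sub_zero, norm_zero, hΦ.map_zero, zero_add, hΦ.youngInv_apply (norm_nonneg _), dist_eq_norm]

end

end VSum

theorem Isometry.isBanachSubspace_range {𝕜 X Y : Type*} [RCLike 𝕜] [AddCommGroup X] [Module 𝕜 X]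
    [MetricSpace X] [NormedAddCommGroup Y] [NormedSpace 𝕜 Y] [CompleteSpace Y] {i : Y →ₗ[𝕜] X}
    (hi : Isometry i) : IsBanachSubspace 𝕜 (LinearMap.range i) := by
  constructor
  · rintro _ ⟨y, rfl⟩ c
    rw [← map_smul, ← map_zero i, hi.dist_eq, hi.dist_eq, dist_zero_right, dist_zero_right,
      norm_smul]
  · rw [LinearMap.coe_range]
    exact hi.isUniformInducing.isComplete_range

theorem exists_norm_eq_of_nontrivial (𝕜 : Type*) [RCLike 𝕜] (E : Type*) [NormedAddCommGroup E]
    [NormedSpace 𝕜 E] [Nontrivial E] {r : ℝ} (hr : 0 ≤ r) : ∃ x : E, ‖x‖ = r := by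
  let _ := NormedSpace.restrictScalars ℝ 𝕜 E
  exact _root_.exists_norm_eq E hr

theorem IsMulhollandYoungFunction.apply_norm_combo_le {Φ : ℝ → ℝ}
    (hΦ : IsMulhollandYoungFunction Φ) {𝕜 E : Type*} [RCLike 𝕜] [NormedAddCommGroup E]
    [NormedSpace 𝕜 E] (u v : E) {a b : ℝ} (ha : 0 ≤ a) (hb : 0 ≤ b) (hab : a + b = 1) :
    Φ ‖(a : 𝕜) • u + (b : 𝕜) • v‖ ≤ a * Φ ‖u‖ + b * Φ ‖v‖ := by
  refine le_trans ?_ (hΦ.convex.2 (mem_univ ‖u‖) (mem_univ ‖v‖) ha hb hab)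
  rw [smul_eq_mul, smul_eq_mul, hΦ.le_iff (norm_nonneg _) (by positivity)]
  refine (norm_add_le _ _).trans_eq ?_
  rw [norm_smul, norm_smul, RCLike.norm_ofReal, RCLike.norm_ofReal, abs_of_nonneg ha,
    abs_of_nonneg hb]

/-! ### Maximality of the two Banach subspaces. -/

namespace IsBentCharacteristic

variable {𝕜 : Type*} [RCLike 𝕜]
variable {X₁ : Type*} [NormedAddCommGroup X₁] [NormedSpace 𝕜 X₁]
variable {X₂ : Type*} [NormedAddCommGroup X₂] [NormedSpace 𝕜 X₂]
variable {χ : ℝ → ℝ} {s : ℝ} [MetricSpace (VSum X₁ X₂)]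

/-- No nonzero vector with components of equal norms lies in a Banach subspace. -/
theorem norm_fst_eq_zero_of_mem (h : IsBentCharacteristic χ s)
    (hd : ∀ x y : VSum X₁ X₂, dist x y = VSum.youngDist (youngOfCharacteristic χ) x y)
    {V : Submodule 𝕜 (VSum X₁ X₂)} (hV : IsBanachSubspace 𝕜 V) {w : VSum X₁ X₂} (hw : w ∈ V)
    (heq : ‖w.1‖ = ‖w.2‖) : ‖w.1‖ = 0 := by
  have hΦ := h.isMulhollandYoungFunction
  by_contra hne
  have hpos : 0 < ‖w.1‖ := (norm_nonneg _).lt_of_ne' hne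
  have hN : ‖w.1‖ ≤ dist w 0 := by
    rw [VSum.dist_zero_eq hd, hΦ.le_youngInv_iff (add_nonneg (hΦ.nonneg _) (hΦ.nonneg _)) hpos.le]
    exact le_add_of_nonneg_right (hΦ.nonneg _)
  -- Rescaling $w$ so that both components have norm $t$, homogeneity reads $\Phi^{-1}(2\Phi(t))=kt$
  -- with this $k$.
  refine h.not_two_mul_eq (k := dist w 0 / ‖w.1‖) (div_pos (hpos.trans_le hN) hpos) fun t ht => ?_
  have e := hV.1 w hw ((t / ‖w.1‖ : ℝ) : 𝕜)
  have e₁ : ‖((((t / ‖w.1‖ : ℝ) : 𝕜)) • w : VSum X₁ X₂).1‖ = t := by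
    change ‖((t / ‖w.1‖ : ℝ) : 𝕜) • w.1‖ = t
    rw [norm_smul, RCLike.norm_ofReal, abs_of_nonneg (by positivity), div_mul_cancel₀ _ hne]
  have e₂ : ‖((((t / ‖w.1‖ : ℝ) : 𝕜)) • w : VSum X₁ X₂).2‖ = t := by
    change ‖((t / ‖w.1‖ : ℝ) : 𝕜) • w.2‖ = t
    rw [norm_smul, RCLike.norm_ofReal, abs_of_nonneg (by positivity), ← heq, div_mul_cancel₀ _ hne]
  rw [VSum.dist_zero_eq hd, e₁, e₂, RCLike.norm_ofReal, abs_of_nonneg (by positivity)] at e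
  rw [show dist w 0 / ‖w.1‖ * t = t / ‖w.1‖ * dist w 0 by ring, ← e,
    hΦ.apply_youngInv (add_nonneg (hΦ.nonneg _) (hΦ.nonneg _)), two_mul]

/-- If $V$ contains $X_1$ and $v\in V$, the first component of $v$ can be changed within $V$ to have
norm $\|v_2\|$, because $X_1\ne0$. Then `norm_fst_eq_zero_of_mem` gives $v_2=0$. -/
theorem isMaximalBanachEmbedding_inl [CompleteSpace X₁] [Nontrivial X₁]
    (h : IsBentCharacteristic χ s)
    (hd : ∀ x y : VSum X₁ X₂, dist x y = VSum.youngDist (youngOfCharacteristic χ) x y) :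
    IsMaximalBanachEmbedding 𝕜 (VSum.inl 𝕜 X₁ X₂) := by
  have hi := VSum.isometry_inl (𝕜 := 𝕜) h.isMulhollandYoungFunction hd
  refine ⟨hi, hi.isBanachSubspace_range, fun V hV hle v hv => ?_⟩
  obtain ⟨x, hx⟩ := exists_norm_eq_of_nontrivial 𝕜 X₁ (norm_nonneg v.2)
  have e₁ : (v + VSum.inl 𝕜 X₁ X₂ (x - v.1)).1 = x := add_sub_cancel v.1 x
  have e₂ : (v + VSum.inl 𝕜 X₁ X₂ (x - v.1)).2 = v.2 := add_zero v.2
  have h0 := h.norm_fst_eq_zero_of_mem hd hV (V.add_mem hv (hle ⟨x - v.1, rfl⟩))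
    (by rw [e₁, e₂, hx])
  rw [e₁, hx, norm_eq_zero] at h0
  exact ⟨v.1, Prod.ext rfl h0.symm⟩

theorem isMaximalBanachEmbedding_inr [CompleteSpace X₂] [Nontrivial X₂]
    (h : IsBentCharacteristic χ s)
    (hd : ∀ x y : VSum X₁ X₂, dist x y = VSum.youngDist (youngOfCharacteristic χ) x y) :
    IsMaximalBanachEmbedding 𝕜 (VSum.inr 𝕜 X₁ X₂) := by
  have hi := VSum.isometry_inr (𝕜 := 𝕜) h.isMulhollandYoungFunction hd
  refine ⟨hi, hi.isBanachSubspace_range, fun V hV hle v hv => ?_⟩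
  obtain ⟨x, hx⟩ := exists_norm_eq_of_nontrivial 𝕜 X₂ (norm_nonneg v.1)
  have e₁ : (v + VSum.inr 𝕜 X₁ X₂ (x - v.2)).1 = v.1 := add_zero v.1
  have e₂ : (v + VSum.inr 𝕜 X₁ X₂ (x - v.2)).2 = x := add_sub_cancel v.2 x
  have h0 := h.norm_fst_eq_zero_of_mem hd hV (V.add_mem hv (hle ⟨x - v.2, rfl⟩))
    (by rw [e₁, e₂, hx])
  rw [e₁, norm_eq_zero] at h0
  exact ⟨v.2, Prod.ext h0.symm rfl⟩

end IsBentCharacteristic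

/-! ### The Banach envelope. -/

namespace VSum

variable {𝕜 : Type*} [RCLike 𝕜]
variable {X₁ : Type*} [NormedAddCommGroup X₁] [NormedSpace 𝕜 X₁]
variable {X₂ : Type*} [NormedAddCommGroup X₂] [NormedSpace 𝕜 X₂]
variable {Φ : ℝ → ℝ} [MetricSpace (VSum X₁ X₂)]

/-- The closed unit ball is already convex. -/
theorem envelopeBall_eq_closedBall (hΦ : IsMulhollandYoungFunction Φ)
    (hd : ∀ x y : VSum X₁ X₂, dist x y = youngDist Φ x y) :
    envelopeBall 𝕜 (VSum X₁ X₂) = Metric.closedBall 0 1 := by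
  let _ : Module ℝ (VSum X₁ X₂) := Module.compHom (VSum X₁ X₂) (algebraMap ℝ 𝕜)
  have hconv : Convex ℝ (Metric.closedBall (0 : VSum X₁ X₂) 1) := by
    intro x hx y hy a b ha hb hab
    rw [Metric.mem_closedBall, dist_zero_le_iff hΦ hd _ zero_le_one] at hx hy ⊢
    change Φ ‖(a : 𝕜) • x.1 + (b : 𝕜) • y.1‖ + Φ ‖(a : 𝕜) • x.2 + (b : 𝕜) • y.2‖ ≤ Φ 1
    have k₁ := hΦ.apply_norm_combo_le (𝕜 := 𝕜) x.1 y.1 ha hb hab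
    have k₂ := hΦ.apply_norm_combo_le (𝕜 := 𝕜) x.2 y.2 ha hb hab
    obtain rfl : b = 1 - a := by linarith
    nlinarith
  change closure (convexHull ℝ (Metric.closedBall (0 : VSum X₁ X₂) 1)) = _
  rw [hconv.convexHull_eq, Metric.isClosed_closedBall.closure_eq]

end VSum

/-- The envelope norm is the norm of the `(1 + s)`-sum. -/
theorem IsBentCharacteristic.envelopeNorm_eq {𝕜 : Type*} [RCLike 𝕜]
    {X₁ : Type*} [NormedAddCommGroup X₁] [NormedSpace 𝕜 X₁]
    {X₂ : Type*} [NormedAddCommGroup X₂] [NormedSpace 𝕜 X₂]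
    {χ : ℝ → ℝ} {s : ℝ} [MetricSpace (VSum X₁ X₂)] (h : IsBentCharacteristic χ s)
    (hd : ∀ x y : VSum X₁ X₂, dist x y = VSum.youngDist (youngOfCharacteristic χ) x y)
    (x : VSum X₁ X₂) :
    envelopeNorm 𝕜 x = (‖x.1‖ ^ (1 + s) + ‖x.2‖ ^ (1 + s)) ^ (1 / (1 + s)) := by
  have hΦ := h.isMulhollandYoungFunction
  have hs : 0 < 1 + s := by linarith [h.slope_nonneg]
  have hn : ∀ {t : ℝ}, 0 ≤ t → 0 ≤ t ^ (1 + s) := fun ht => Real.rpow_nonneg ht _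
  set N := (‖x.1‖ ^ (1 + s) + ‖x.2‖ ^ (1 + s)) ^ (1 / (1 + s))
  have hN : 0 ≤ N := Real.rpow_nonneg (add_nonneg (hn (norm_nonneg _)) (hn (norm_nonneg _))) _
  have hset : {r : ℝ | 0 < r ∧ (r : 𝕜)⁻¹ • x ∈ envelopeBall 𝕜 (VSum X₁ X₂)} =
      {r : ℝ | 0 < r ∧ N ≤ r} := by
    ext r
    refine and_congr_right fun hr => ?_
    rw [VSum.envelopeBall_eq_closedBall hΦ hd, Metric.mem_closedBall,
      VSum.dist_zero_le_iff hΦ hd _ zero_le_one]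
    change _ + youngOfCharacteristic χ ‖(r : 𝕜)⁻¹ • x.2‖ ≤ _ ↔ _
    change youngOfCharacteristic χ ‖(r : 𝕜)⁻¹ • x.1‖ + _ ≤ _ ↔ _
    rw [h.young_add_le_iff (norm_nonneg _) (norm_nonneg _), norm_smul, norm_smul, norm_inv,
      RCLike.norm_ofReal, abs_of_pos hr, Real.mul_rpow (inv_nonneg.2 hr.le) (norm_nonneg _),
      Real.mul_rpow (inv_nonneg.2 hr.le) (norm_nonneg _), ← mul_add, Real.inv_rpow hr.le,
      inv_mul_le_one₀ (Real.rpow_pos_of_pos hr _)]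
    simp only [N, one_div]
    rw [Real.rpow_inv_le_iff_of_pos (add_nonneg (hn (norm_nonneg _)) (hn (norm_nonneg _))) hr.le hs]
  rw [envelopeNorm, hset]
  rcases hN.eq_or_lt with hN | hN
  · have : {r : ℝ | 0 < r ∧ N ≤ r} = Ioi 0 := by
      ext r
      simpa [← hN] using le_of_lt
    rw [this, csInf_Ioi, hN]
  · have : {r : ℝ | 0 < r ∧ N ≤ r} = Ici N := by
      ext r
      simpa using fun hr => hN.trans_le hr
    rw [this, csInf_Ici]

/-! ### The two explicit characteristic functions. -/

/-- The characteristic function of `max (|x| ^ p) (|x| ^ (p + 1))`, with `s = p - 1`. -/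
theorem isBentCharacteristic_add_max {s : ℝ} (hs : 0 ≤ s) :
    IsBentCharacteristic (fun u => s * u + max u 0) s where
  slope_nonneg := hs
  exists_support u := by
    rcases le_total u 0 with hu | hu
    · refine ⟨s, hs, fun v => ?_⟩
      rw [max_eq_right hu]
      nlinarith [le_max_right v 0]
    · refine ⟨s + 1, by linarith, fun v => ?_⟩
      rw [max_eq_left hu]
      nlinarith [le_max_left v 0]
  eq_of_nonpos u hu := by simp [hu]
  exists_lt := ⟨1, by simp⟩

/-- The weight `2⁻ʳ ((r + 2) l - u)` of the `r`-th supporting line of `dyadicCharacteristic`. -/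
noncomputable def dyadicExcess (l : ℝ) (r : ℕ) (u : ℝ) : ℝ := ((r + 2) * l - u) / 2 ^ r

/-- The piecewise linear function whose slope on `[r log 2, (r + 1) log 2]` is `a - d / 2 ^ r`,
with asymptote `a x + b`. -/
noncomputable def dyadicCharacteristic (a b d : ℝ) (u : ℝ) : ℝ :=
  a * u + b + d * dyadicExcess (Real.log 2) ⌊u / Real.log 2⌋₊ u

/-- Consecutive lines cross exactly at $u=(r+1)l$, which explains the constant $r+2$. For fixed
$u\ge0$ the values therefore rise up to index $\lfloor u/l\rfloor$ and do not rise afterwards, so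
`dyadicCharacteristic` is the supremum of its lines. -/
theorem dyadicExcess_succ_sub (l : ℝ) (r : ℕ) (u : ℝ) :
    dyadicExcess l (r + 1) u - dyadicExcess l r u = (u - (r + 1) * l) / 2 ^ (r + 1) := by
  simp only [dyadicExcess]
  push_cast
  field_simp
  ring

theorem dyadicExcess_le_of_le {l u : ℝ} {n : ℕ} (hl : 0 ≤ l) (hn : n * l ≤ u) {j : ℕ} (hj : j ≤ n) :
    dyadicExcess l j u ≤ dyadicExcess l n u := by
  induction n, hj using Nat.le_induction with
  | base => rfl
  | succ n hjn ih =>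
    push_cast at hn
    refine (ih (by linarith)).trans (sub_nonneg.1 ?_)
    rw [dyadicExcess_succ_sub]
    exact div_nonneg (by linarith) (by positivity)

theorem dyadicExcess_le_of_ge {l u : ℝ} {n : ℕ} (hl : 0 ≤ l) (hn : u ≤ (n + 1) * l) {j : ℕ}
    (hj : n ≤ j) : dyadicExcess l j u ≤ dyadicExcess l n u := by
  induction j, hj using Nat.le_induction with
  | base => rfl
  | succ j hnj ih =>
    refine le_trans (sub_nonpos.1 ?_) ih
    rw [dyadicExcess_succ_sub]
    refine div_nonpos_of_nonpos_of_nonneg (sub_nonpos.2 (hn.trans ?_)) (by positivity)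
    gcongr

theorem dyadicExcess_le_floor {l : ℝ} (hl : 0 < l) (j : ℕ) (u : ℝ) :
    dyadicExcess l j u ≤ dyadicExcess l ⌊u / l⌋₊ u := by
  have h₂ : u ≤ (⌊u / l⌋₊ + 1) * l := ((div_lt_iff₀ hl).1 (Nat.lt_floor_add_one _)).le
  rcases le_total j ⌊u / l⌋₊ with hj | hj
  · rcases le_total 0 u with hu | hu
    · exact dyadicExcess_le_of_le hl.le
        ((le_div_iff₀ hl).1 (Nat.floor_le (div_nonneg hu hl.le))) hj
    -- The natural-number floor is $0$ for $u\le0$, so the line of index $0$ continues over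
    -- $(-\infty,0]$.
    · rw [Nat.floor_of_nonpos (div_nonpos_of_nonpos_of_nonneg hu hl.le)] at hj ⊢
      rw [Nat.le_zero.1 hj]
  · exact dyadicExcess_le_of_ge hl.le h₂ hj

/-- At the right endpoint the floor is $r+1$, but there the two neighbouring lines agree. -/
theorem dyadicExcess_floor_eq {l : ℝ} (hl : 0 < l) {r : ℕ} {u : ℝ} (h₁ : r * l ≤ u)
    (h₂ : u ≤ (r + 1) * l) : dyadicExcess l ⌊u / l⌋₊ u = dyadicExcess l r u := by
  refine le_antisymm ?_ (dyadicExcess_le_floor hl r u)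
  exact dyadicExcess_le_of_ge hl.le h₂ (Nat.le_floor ((le_div_iff₀ hl).2 h₁))

section

variable {a d : ℝ}

theorem dyadicCharacteristic_of_nonpos (a b d : ℝ) {u : ℝ} (hu : u ≤ 0) :
    dyadicCharacteristic a b d u = dyadicCharacteristic a b d 0 + (a - d) * u := by
  rw [dyadicCharacteristic, dyadicCharacteristic, Nat.floor_of_nonpos
    (div_nonpos_of_nonpos_of_nonneg hu (Real.log_pos one_lt_two).le), zero_div, Nat.floor_zero]
  simp only [dyadicExcess]
  ring

theorem isPiecewiseLinearWithSlopes_dyadicCharacteristic (a b d : ℝ) :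
    IsPiecewiseLinearWithSlopes (dyadicCharacteristic a b d) (fun r => a - d / 2 ^ r) := by
  have hl : 0 < Real.log 2 := Real.log_pos one_lt_two
  refine ⟨fun r x hx => ?_, fun x hx => ?_⟩
  · rw [dyadicCharacteristic, dyadicCharacteristic, dyadicExcess_floor_eq hl hx.1 hx.2,
      dyadicExcess_floor_eq hl le_rfl (by linarith : r * Real.log 2 ≤ (r + 1) * Real.log 2)]
    simp only [dyadicExcess]
    ring
  · simpa using dyadicCharacteristic_of_nonpos a b d hx

theorem isBentCharacteristic_dyadicCharacteristic (b : ℝ) (hd : 0 < d) (hda : d < a) :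
    IsBentCharacteristic (dyadicCharacteristic a b d) (a - d) where
  slope_nonneg := by linarith
  exists_support u := by
    refine ⟨a - d / 2 ^ ⌊u / Real.log 2⌋₊, ?_, fun v => ?_⟩
    · have := div_le_self hd.le (one_le_pow₀ one_le_two : (1 : ℝ) ≤ 2 ^ ⌊u / Real.log 2⌋₊)
      linarith
    · refine le_trans (le_of_eq ?_) (add_le_add_right (mul_le_mul_of_nonneg_left
        (dyadicExcess_le_floor (Real.log_pos one_lt_two) ⌊u / Real.log 2⌋₊ v) hd.le) _)
      simp only [dyadicCharacteristic, dyadicExcess]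
      ring
  eq_of_nonpos u hu := dyadicCharacteristic_of_nonpos a b d hu
  exists_lt := by
    have hl : 0 < Real.log 2 := Real.log_pos one_lt_two
    -- The initial slope persists up to $\log 2$, so the witness must lie beyond it; here the gap is
    -- $(d/2)\log 2$.
    refine ⟨2 * Real.log 2, ?_⟩
    simp only [dyadicCharacteristic, dyadicExcess]
    rw [mul_div_cancel_right₀ _ hl.ne', zero_div, Nat.floor_zero, Nat.floor_ofNat]
    norm_num
    nlinarith [mul_pos hd hl]

theorem hasAsymptoteAtTop_dyadicCharacteristic (a b : ℝ) (hd : 0 < d) :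
    HasAsymptoteAtTop (dyadicCharacteristic a b d) a b := by
  have hl : 0 < Real.log 2 := Real.log_pos one_lt_two
  have hfl : Tendsto (fun u : ℝ => ⌊u / Real.log 2⌋₊) atTop atTop :=
    tendsto_nat_floor_atTop.comp (tendsto_id.atTop_div_const hl)
  -- With $r=\lfloor u/\log 2\rfloor$ and $u\ge r\log 2$, the factor $(r+2)\log 2-u$ is at most
  -- $2\log 2$.
  have hlim : Tendsto (fun u : ℝ => d * (2 * Real.log 2) * (1 / 2) ^ ⌊u / Real.log 2⌋₊)
      atTop (𝓝 0) := by
    have := ((tendsto_pow_atTop_nhds_zero_of_lt_one (by norm_num : (0 : ℝ) ≤ 1 / 2)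
      (by norm_num)).comp hfl).const_mul (d * (2 * Real.log 2))
    simpa using this
  refine squeeze_zero' ?_ ?_ hlim
  · refine Eventually.of_forall fun u => ?_
    have h₂ : u ≤ (⌊u / Real.log 2⌋₊ + 1) * Real.log 2 :=
      ((div_lt_iff₀ hl).1 (Nat.lt_floor_add_one _)).le
    rw [dyadicCharacteristic, add_sub_cancel_left]
    exact mul_nonneg hd.le (div_nonneg (by linarith) (by positivity))
  · filter_upwards [eventually_ge_atTop 0] with u hu
    have h₁ : ⌊u / Real.log 2⌋₊ * Real.log 2 ≤ u :=
      (le_div_iff₀ hl).1 (Nat.floor_le (div_nonneg hu hl.le))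
    rw [dyadicCharacteristic, add_sub_cancel_left, mul_assoc, one_div_pow, mul_one_div]
    refine mul_le_mul_of_nonneg_left ?_ hd.le
    rw [dyadicExcess]
    gcongr
    linarith

theorem strictMono_sub_div_two_pow (a : ℝ) (hd : 0 < d) :
    StrictMono fun r : ℕ => a - d / 2 ^ r := by
  refine strictMono_nat_of_lt_succ fun r => ?_
  have : d / 2 ^ (r + 1) < d / 2 ^ r :=
    div_lt_div_of_pos_left hd (by positivity) (pow_lt_pow_right₀ one_lt_two r.lt_succ_self)
  linarith

theorem tendsto_sub_div_two_pow (a d : ℝ) :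
    Tendsto (fun r : ℕ => a - d / 2 ^ r) atTop (𝓝 a) := by
  have := ((tendsto_pow_atTop_nhds_zero_of_lt_one (by norm_num : (0 : ℝ) ≤ 1 / 2)
      (by norm_num)).const_mul d).const_sub a
  simpa [div_eq_mul_inv] using this

end

/-! ### Comparison of norms and the main theorem. -/

/-- Comparison of the `q`-norm with the `p`-norm on the plane, for `q ≤ p`. -/
theorem rpow_add_rpow_le_two_rpow_mul {x y p q : ℝ} (hx : 0 ≤ x) (hy : 0 ≤ y) (hq : 0 < q)
    (hqp : q ≤ p) :
    (x ^ q + y ^ q) ^ (1 / q) ≤ 2 ^ (1 / q - 1 / p) * (x ^ p + y ^ p) ^ (1 / p) := by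
  have hp : 0 < p := hq.trans_le hqp
  lift x to NNReal using hx
  lift y to NNReal using hy
  -- Power mean inequality with exponent $p/q\ge1$; the $p$-th root is taken below.
  have h := NNReal.rpow_add_le_mul_rpow_add_rpow (x ^ q) (y ^ q) ((one_le_div hq).2 hqp)
  rw [← NNReal.rpow_mul, ← NNReal.rpow_mul, mul_div_cancel₀ _ hq.ne'] at h
  have h' := NNReal.rpow_le_rpow h (one_div_nonneg.2 hp.le)
  rw [NNReal.mul_rpow, ← NNReal.rpow_mul, ← NNReal.rpow_mul,
    show p / q * (1 / p) = 1 / q by field_simp,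
    show (p / q - 1) * (1 / p) = 1 / q - 1 / p by field_simp] at h'
  exact_mod_cast h'

/-- The factor compares the $(p-d)$-norm with the $p$-norm and equals $1$ at $d=0$; $d<p-1$ keeps
the first slope $p-1-d$ positive. -/
theorem exists_two_rpow_le {p ε : ℝ} (hp : 1 < p) (hε : 0 < ε) :
    ∃ d, 0 < d ∧ d < p - 1 ∧ (2 : ℝ) ^ (1 / (p - d) - 1 / p) ≤ 1 + ε := by
  have hc : ContinuousAt (fun d : ℝ => (2 : ℝ) ^ (1 / (p - d) - 1 / p)) 0 := by
    refine ContinuousAt.rpow continuousAt_const ?_ (Or.inl two_ne_zero)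
    refine (continuousAt_const.div (by fun_prop) ?_).sub continuousAt_const
    linarith
  have h₁ : ∀ᶠ d in 𝓝[>] (0 : ℝ), (2 : ℝ) ^ (1 / (p - d) - 1 / p) < 1 + ε :=
    (hc.eventually_lt continuousAt_const (by simpa using hε)).filter_mono nhdsWithin_le_nhds
  obtain ⟨d, hd, hd'⟩ := (h₁.and (Ioo_mem_nhdsGT (sub_pos.2 hp))).exists
  exact ⟨d, hd'.1, hd'.2, hd.le⟩

theorem VSum.norm_toLp {𝕜 : Type*} [RCLike 𝕜]
    {X₁ : Type*} [NormedAddCommGroup X₁] [NormedSpace 𝕜 X₁]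
    {X₂ : Type*} [NormedAddCommGroup X₂] [NormedSpace 𝕜 X₂]
    {p : ℝ≥0∞} [Fact (1 ≤ p)] (hp : 0 < p.toReal) (x : VSum X₁ X₂) :
    ‖VSum.toLp 𝕜 X₁ X₂ p x‖ =
      (‖x.1‖ ^ p.toReal + ‖x.2‖ ^ p.toReal) ^ (1 / p.toReal) :=
  WithLp.prod_norm_eq_add hp _

theorem mainTheorem3 {𝕜 : Type*} [RCLike 𝕜]
    (X₁ : Type*) [NormedAddCommGroup X₁] [NormedSpace 𝕜 X₁] [CompleteSpace X₁] [Nontrivial X₁]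
    (X₂ : Type*) [NormedAddCommGroup X₂] [NormedSpace 𝕜 X₂] [CompleteSpace X₂] [Nontrivial X₂]
    (p : ℝ≥0∞) [Fact (1 ≤ p)] (hp : p ≠ ∞) :
    (∃ Ω : ℝ → ℝ, IsMulhollandYoungFunction Ω ∧
      ∃ inst : MetricSpace (VSum X₁ X₂),
        (∀ x y : VSum X₁ X₂, dist x y = VSum.youngDist Ω x y) ∧
        IsPInterpolationFSpace 𝕜 (VSum X₁ X₂) p X₁ X₂ ∧
        IsMaximalBanachEmbedding 𝕜 (VSum.inl 𝕜 X₁ X₂) ∧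
        IsMaximalBanachEmbedding 𝕜 (VSum.inr 𝕜 X₁ X₂) ∧
        IsBanachEnvelope 𝕜 (VSum.toLp 𝕜 X₁ X₂ p)) ∧
    (1 < p → ∀ ε : ℝ, 0 < ε →
      ∃ (Ω χ : ℝ → ℝ) (m : ℕ → ℝ),
        IsMulhollandYoungFunction Ω ∧ IsCharacteristicFunction χ Ω ∧
        0 < m 0 ∧ StrictMono m ∧ Tendsto m atTop (𝓝 (p.toReal - 1)) ∧
        IsPiecewiseLinearWithSlopes χ m ∧
        HasAsymptoteAtTop χ (p.toReal - 1) (-Real.log p.toReal) ∧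
        ∃ inst : MetricSpace (VSum X₁ X₂),
          (∀ x y : VSum X₁ X₂, dist x y = VSum.youngDist Ω x y) ∧
          IsFSpace 𝕜 (VSum X₁ X₂) ∧
          IsLocallyBoundedSpace 𝕜 (VSum X₁ X₂) ∧
          IsMaximalBanachEmbedding 𝕜 (VSum.inl 𝕜 X₁ X₂) ∧
          IsMaximalBanachEmbedding 𝕜 (VSum.inr 𝕜 X₁ X₂) ∧
          HasSeparatingDual 𝕜 (VSum X₁ X₂) ∧
          ∀ x : VSum X₁ X₂, ‖VSum.toLp 𝕜 X₁ X₂ p x‖ ≤ envelopeNorm 𝕜 x ∧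
            envelopeNorm 𝕜 x ≤ (1 + ε) * ‖VSum.toLp 𝕜 X₁ X₂ p x‖) := by
  have hp1 : 1 ≤ p.toReal := by
    simpa using ENNReal.toReal_mono hp (Fact.out : (1 : ℝ≥0∞) ≤ p)
  have hp0 : 0 < p.toReal := one_pos.trans_le hp1
  refine ⟨?_, fun hp' ε hε => ?_⟩
  · have h := isBentCharacteristic_add_max (sub_nonneg.2 hp1)
    have hΦ := h.isMulhollandYoungFunction
    refine ⟨_, hΦ, VSum.youngMetricSpace hΦ, fun _ _ => rfl, ?_⟩
    let _ : MetricSpace (VSum X₁ X₂) := VSum.youngMetricSpace hΦ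
    have hd : ∀ x y : VSum X₁ X₂, dist x y = VSum.youngDist _ x y := fun _ _ => rfl
    have hl := h.isMaximalBanachEmbedding_inl (𝕜 := 𝕜) hd
    have hr := h.isMaximalBanachEmbedding_inr (𝕜 := 𝕜) hd
    have he : IsBanachEnvelope 𝕜 (VSum.toLp 𝕜 X₁ X₂ p) :=
      { separating := VSum.hasSeparatingDual hΦ hd
        complete := inferInstance
        norm_eq := fun x => by
          rw [h.envelopeNorm_eq hd, VSum.norm_toLp hp0, add_sub_cancel] }
    exact ⟨⟨VSum.isFSpace hΦ hd, VSum.isLocallyBoundedSpace hΦ hd, ⟨_, hl⟩, ⟨_, hr⟩, ⟨_, he⟩⟩,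
      hl, hr, he⟩
  · have hp1' : 1 < p.toReal := by
      simpa using (ENNReal.toReal_lt_toReal ENNReal.one_ne_top hp).2 hp'
    obtain ⟨d, hd0, hdp, hdε⟩ := exists_two_rpow_le hp1' hε
    -- The intercept is free: it only multiplies $\Omega$ by a constant, which leaves $d_\Omega$
    -- unchanged.
    have h := isBentCharacteristic_dyadicCharacteristic (-Real.log p.toReal) hd0 hdp
    have hΦ := h.isMulhollandYoungFunction
    refine ⟨_, _, _, hΦ, isCharacteristicFunction_youngOfCharacteristic _, ?_,
      strictMono_sub_div_two_pow _ hd0, tendsto_sub_div_two_pow _ _,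
      isPiecewiseLinearWithSlopes_dyadicCharacteristic _ _ _,
      hasAsymptoteAtTop_dyadicCharacteristic _ _ hd0, VSum.youngMetricSpace hΦ,
      fun _ _ => rfl, ?_⟩
    · simpa using hdp
    let _ : MetricSpace (VSum X₁ X₂) := VSum.youngMetricSpace hΦ
    have hd : ∀ x y : VSum X₁ X₂, dist x y = VSum.youngDist _ x y := fun _ _ => rfl
    refine ⟨VSum.isFSpace hΦ hd, VSum.isLocallyBoundedSpace hΦ hd,
      h.isMaximalBanachEmbedding_inl hd, h.isMaximalBanachEmbedding_inr hd,
      VSum.hasSeparatingDual hΦ hd, fun x => ?_⟩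
    have hq : 1 + (p.toReal - 1 - d) = p.toReal - d := by ring
    rw [h.envelopeNorm_eq hd, VSum.norm_toLp hp0, hq]
    have hq0 : 0 < p.toReal - d := by linarith
    have hqp : p.toReal - d ≤ p.toReal := by linarith
    refine ⟨Real.rpow_add_rpow_le (norm_nonneg _) (norm_nonneg _) hq0 hqp, ?_⟩
    refine (rpow_add_rpow_le_two_rpow_mul (norm_nonneg _) (norm_nonneg _) hq0 hqp).trans ?_
    gcongr
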